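/- **Cuckoo hashing.** Let $U$ (identifiers) and $V$ (values) be sets and let $n,k,b,\ell,s$ be natural numbers with $k\le b$. The scheme $\mathsf{CH}(k,b,\ell,s)$ for $n$ items splits $b$ entries into $k$ disjoint sub-tables of sizes $\lfloor (b+i)/k\rfloor$, $0\le i<k$ (that is, $b/k$ each when $k\mid b$). The hash functions $H_1,\dots,H_k$ are random: $H_i$ maps $U$ to the $i$-th sub-table, and all values $H_i(x)$ are independent and uniform. Each entry has room for $\ell$ items, and there is a stash with room for $s$ items. An item $(x,v)\in U\times V$ may be placed in the entries $H_1(x),\dots,H_k(x)$ or in the stash. On an input set of $n$ items with distinct identifiers the (possibly randomized) construction algorithm outputs either a table in which every item of the set occupies exactly one location, at an allowed place, or $\perp$. It is *perfect* if, for every such set, with probability $1$ over the hash functions it does not output $\perp$ when such a table exists. **Robustness.** An adversary is a randomized algorithm with oracle access to $x\mapsto(H_1(x),\dots,H_k(x))$ that outputs a set of items; each oracle query, coin toss and elementary step costs one unit of time. Its failure probability is the probability (over the hash functions, its coins and those of the construction) that it outputs a set of $n$ items with distinct identifiers on which the construction outputs $\perp$. For a family of schemes indexed by the number $n$ of items,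 and $\varepsilon:\mathbb N\to\mathbb R$, the family is $(n,\varepsilon)$-*strongly robust* if, for every polynomial $t$ and every family of adversaries $(\mathcal A_n)$ with running time $O(t(n))$, the failure probability of $\mathcal A_n$ is at most $\varepsilon(n)$ for all sufficiently large $n$. A function $\varepsilon$ is *negligible* if $n^c\varepsilon(n)\to0$ for every $c$. **Statement.** For every real constant $\alpha>1$ there is a constant $C>0$, depending only on $\alpha$, such that the following holds. Let $f:\mathbb N\to\mathbb R$ with $f(n)\to\infty$, let $b(n)=\lceil\alpha n\rceil$, let $k(n)\le b(n)$ be natural numbers, and consider, with arbitrary universes $U_n,V_n$, the schemes $\mathsf{CH}(k(n),b(n),1,0)$ (entries of size $\ell=1$, no stash, $s=0$) for $n$ items with any perfect construction algorithms. Then: 1. $\varepsilon(n)=n^{-f(n)}$ is negligible. 2. If $k(n)\ge C f(n)\log n$ for all large $n$ (in particular if $k(n)=\lceil C f(n)\log n\rceil=O(f(n)\log n)$ for all large $n$), then the family is $(n,n^{-f(n)})$-strongly robust. 3. If $f(n)\log n=O(k(n))$ (in particular if $k(n)=\Theta(f(n)\log n)$, with any implied constants), then the family is $(n,\nu)$-strongly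 robust for some negligible $\nu$. -/

import Mathlib

open Filter MeasureTheory Asymptotics
open scoped ENNReal

/-- `X` is a set of `n` identifier-value pairs with pairwise distinct identifiers. -/
def IsItemSet {U V : Type*} (n : ℕ) (X : Finset (U × V)) : Prop :=
  X.card = n ∧ Set.InjOn Prod.fst (X : Set (U × V))

/-- A hashing scheme for sets of `n` items over the identifier universe `U` and the value universe
`V`. The sampled hash functions are recorded as a single map `H : U → Range`, which returns the
values of all of them; `IsAllocation H X T` says that the table `T` is a successful allocation of
`X` according to `H`. The algorithm `construct` may be randomized, and returns either a table
allocating `X` or `none` (failure). -/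
structure HashingScheme.{u, v} (n : ℕ) (U : Type u) (V : Type v) where
  Range : Type
  measurableRange : MeasurableSpace Range
  Table : Type (max u v)
  sample : Measure (U → Range)
  IsAllocation : (U → Range) → Finset (U × V) → Table → Prop
  construct : (U → Range) → Finset (U × V) → PMF (Option Table)
  query : (U → Range) → Table → U → Option V
  construct_sound : ∀ H X T, IsItemSet n X → some T ∈ (construct H X).support → IsAllocation H X T

/-- The construction algorithm is perfect: for every set `X` of `n` items, with probability one over
the sampled hash functions, it does not fail if a successful allocation of `X` exists. -/
def HashingScheme.IsPerfect {n : ℕ} {U V : Type*} (S : HashingScheme n U V) : Prop :=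
  letI := S.measurableRange
  ∀ X : Finset (U × V), IsItemSet n X →
    ∀ᵐ H ∂S.sample, (∃ T, S.IsAllocation H X T) → S.construct H X none = 0

/-- A randomized oracle computation, as the tree of its possible executions: it stops with an
output, or asks the oracle for its value at a point, or tosses a fair coin, or performs an
elementary step of internal computation, and then goes on in a way that may depend on everything it
has seen. (No uniformity is imposed, so every probabilistic oracle machine unfolds to such a
tree.) -/
inductive OracleComp (U R O : Type*) where
  | output (x : O) : OracleComp U R O
  | query (x : U) (next : R → OracleComp U R O) : OracleComp U R O
  | toss (next : Bool → OracleComp U R O) : OracleComp U R O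
  | step (next : OracleComp U R O) : OracleComp U R O

namespace OracleComp

/-- The distribution of the output when the oracle is `H`. -/
noncomputable def run {U R O : Type*} (H : U → R) : OracleComp U R O → PMF O
  | output x => PMF.pure x
  | query x next => run H (next (H x))
  | toss next => (PMF.uniformOfFintype Bool).bind fun c => run H (next c)
  | step next => run H next

/-- The running time is at most `t` whatever the oracle and the coins answer; each oracle query,
coin toss and elementary step takes one unit of time. -/
def RunsWithin {U R O : Type*} : OracleComp U R O → ℕ → Prop
  | output _, _ => True
  | query _ _, 0 => False
  | query _ next, t + 1 => ∀ r, RunsWithin (next r) t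
  | toss _, 0 => False
  | toss next, t + 1 => ∀ c, RunsWithin (next c) t
  | step _, 0 => False
  | step next, t + 1 => RunsWithin next t

end OracleComp

/-- An adversary against `S`: it may evaluate the sampled hash functions and outputs a set of
items. -/
abbrev HashingScheme.Adversary {n : ℕ} {U V : Type*} (S : HashingScheme n U V) :=
  OracleComp U S.Range (Finset (U × V))

open Classical in
/-- The probability, over the sampled hash functions `H`, the coins of the adversary and those of
the construction algorithm, that the adversary outputs a set `X` of `n` items with distinct
identifiers for which the construction fails. -/
noncomputable def HashingScheme.failProb {n : ℕ} {U V : Type*} (S : HashingScheme n U V)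
    (A : S.Adversary) : ℝ≥0∞ :=
  letI := S.measurableRange
  ∫⁻ H, ∑' X, A.run H X * (if IsItemSet n X then S.construct H X none else 0) ∂S.sample

/-- `(Q, ε)`-robustness of a family of schemes, the `n`-th one for `n` items: every family of
adversaries with running time `O(Q n)` makes the construction fail with probability at most `ε n`,
for all large `n`. -/
def IsRobust {U V : ℕ → Type*} (S : ∀ n, HashingScheme n (U n) (V n)) (Q : ℕ → ℕ) (ε : ℕ → ℝ) :
    Prop :=
  ∀ (A : ∀ n, (S n).Adversary) (c : ℕ), (∀ᶠ n in atTop, (A n).RunsWithin (c * Q n)) →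
    ∀ᶠ n in atTop, (S n).failProb (A n) ≤ ENNReal.ofReal (ε n)

/-- `(lam, ε)`-strong robustness: `(t, ε)`-robustness for every polynomial `t(n, lam)`. -/
def IsStronglyRobust {U V : ℕ → Type*} (S : ∀ n, HashingScheme n (U n) (V n)) (lam : ℕ → ℕ)
    (ε : ℕ → ℝ) : Prop :=
  ∀ t : MvPolynomial (Fin 2) ℕ, IsRobust S (fun n => MvPolynomial.eval ![n, lam n] t) ε

/-- `ε` is negligible: `n ^ c * ε n` tends to `0` for every `c`. -/
abbrev IsNegligible (ε : ℕ → ℝ) : Prop :=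
  SuperpolynomialDecay atTop (fun n : ℕ => (n : ℝ)) ε

namespace Cuckoo

/-- The number of entries of the `i`-th of the `k` disjoint sub-tables into which `b` entries are
split: `b / k` if `k` divides `b`, and in general `⌊b / k⌋` or `⌈b / k⌉`, summing up to `b`. -/
def subtableSize (k b : ℕ) (i : Fin k) : ℕ := (b + i) / k

/-- The values at one identifier of the `k` hash functions, the `i`-th of which selects an entry of
the `i`-th sub-table. -/
abbrev HashValue (k b : ℕ) := (i : Fin k) → Fin (subtableSize k b i)

theorem hashValue_nonempty {k b : ℕ} (h : k ≤ b) : Nonempty (HashValue k b) :=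
  ⟨fun i => ⟨0, Nat.div_pos (h.trans (Nat.le_add_right b i)) (i.val.zero_le.trans_lt i.isLt)⟩⟩

/-- Random hash functions: the tuples `H x`, for `x` in `U`, are independent and uniform. -/
noncomputable def randomHash (U : Type*) {k b : ℕ} (h : k ≤ b) : Measure (U → HashValue k b) :=
  haveI := hashValue_nonempty h
  Measure.infinitePi fun _ : U => (PMF.uniformOfFintype (HashValue k b)).toMeasure

/-- The locations of a table: `l` in each of the `b` entries, and `s` in the stash. -/
abbrev Slot (k b l s : ℕ) := (((i : Fin k) × Fin (subtableSize k b i)) × Fin l) ⊕ Fin s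

/-- The location may hold an item whose identifier has the hash values `h`: it is in one of the `k`
selected entries, or in the stash. -/
def Allowed {k b l s : ℕ} (h : HashValue k b) : Slot k b l s → Prop
  | Sum.inl (⟨i, j⟩, _) => h i = j
  | Sum.inr _ => True

/-- A table: each location is empty or holds one item. -/
abbrev Table (k b l s : ℕ) (U V : Type*) := Slot k b l s → Option (U × V)

/-- `T` stores exactly the items of `X`, each of them once and in an allowed location. -/
def IsAllocation {k b l s : ℕ} {U V : Type*} (H : U → HashValue k b) (X : Finset (U × V))
    (T : Table k b l s U V) : Prop :=
  (∀ p x, T p = some x → x ∈ X ∧ Allowed (H x.1) p) ∧ ∀ x ∈ X, ∃! p, T p = some x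

open Classical in
/-- Look for an item with identifier `u` in the locations that are allowed for `u`. -/
noncomputable def query {k b l s : ℕ} {U V : Type*} (H : U → HashValue k b)
    (T : Table k b l s U V) (u : U) : Option V :=
  if h : ∃ v, ∃ p, Allowed (H u) p ∧ T p = some (u, v) then some h.choose else none

/-- A construction algorithm for cuckoo hashing tables with `n` items: given the hash functions and
the items, it returns a successful allocation or `none`. -/
structure Construction (n k b l s : ℕ) (U V : Type*) where
  run : (U → HashValue k b) → Finset (U × V) → PMF (Option (Table k b l s U V))
  sound : ∀ H X T, IsItemSet n X → some T ∈ (run H X).support → IsAllocation H X T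

/-- The cuckoo hashing scheme `CH(k, b, l, s)` for `n` items with random hash functions, `k`
disjoint sub-tables, and the construction algorithm `C`. -/
noncomputable def CH {n k b l s : ℕ} {U V : Type*} (hkb : k ≤ b)
    (C : Construction n k b l s U V) : HashingScheme n U V where
  Range := HashValue k b
  measurableRange := inferInstance
  Table := Table k b l s U V
  sample := randomHash U hkb
  IsAllocation := IsAllocation
  construct := C.run
  query := query
  construct_sound := C.sound

end Cuckoo

/-! By Hall's theorem, an item set that cannot be allocated has more than `S.card` identifiers whose
selected entries all lie in one set `S` of fewer than `n` entries
(`exists_confined_of_not_isAllocation`). Since `S` occupies at most a fraction `1/α` of the entries,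
one fresh hash value is confined to `S` with probability at most `p = exp(-(1 - 1/α)k/2)`
(`card_confined_div_le`).

The adversary chooses identifiers adaptively, but `t` queries and `n` output items involve at most
`t + n` hash values, each fresh when first seen. Giving every confined identifier the weight `1/y ≥
1`, the expected product of the weights over the output is at most `(1 + p/y)^(t+n)`
(`lintegral_expect_prod_le`). A union bound over `S`, with factor `y^(S.card+1)`, gives the failure
bound `y(1+y)^b(1+p/y)^(t+n)` (`failProb_le`).

With `y = p(t+n)`, both powers are at most `e` as soon as `p(t+n)b ≤ 1`, so failure has probability
at most `9p(t+n)`. If `k ≥ 4/(1 - 1/α) · f log n`, then `p ≤ n^(-2f)`: one factor `n^(-f)` absorbs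
all polynomials, the other is the claimed bound. -/

/-! ### Independent families of hash values. -/

section Resampling

variable {U R : Type*} [MeasurableSpace R] (ν : Measure R) [IsProbabilityMeasure ν]

open Classical in
/-- Resampling one coordinate of an i.i.d. family does not change its law. -/
theorem lintegral_infinitePi_update {F : (U → R) → ℝ≥0∞} (hF : Measurable F) (x : U) :
    ∫⁻ H, F H ∂Measure.infinitePi (fun _ : U => ν) =
      ∫⁻ r, ∫⁻ H, F (Function.update H x r) ∂Measure.infinitePi (fun _ : U => ν) ∂ν := by
  have hm : Measurable fun p : R × (U → R) => Function.update p.2 x p.1 := by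
    refine measurable_pi_lambda _ fun y => ?_
    by_cases h : y = x
    · subst h
      simpa using measurable_fst
    · simpa [h, Function.comp_def] using (measurable_pi_apply y).comp measurable_snd
  -- An infinite product measure is determined by its values on finite boxes; the preimage of a box
  -- is again a box, with side `x` moved to the new coordinate.
  have key : (ν.prod (Measure.infinitePi fun _ : U => ν)).map
      (fun p : R × (U → R) => Function.update p.2 x p.1) =
        Measure.infinitePi (fun _ : U => ν) := by
    refine Measure.eq_infinitePi _ fun s t ht => ?_
    rw [Measure.map_apply hm (MeasurableSet.pi s.countable_toSet fun i _ => ht i)]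
    have hpre : (fun p : R × (U → R) => Function.update p.2 x p.1) ⁻¹' Set.pi s t =
        (if x ∈ s then t x else Set.univ) ×ˢ Set.pi (s.erase x : Finset U) t := by
      ext ⟨r, H⟩
      simp only [Set.mem_preimage, Set.mem_pi, Set.mem_prod, Finset.mem_coe, Finset.mem_erase]
      constructor
      · intro h
        refine ⟨?_, fun i hi => by simpa [hi.1] using h i hi.2⟩
        split_ifs with hx
        · simpa using h x hx
        · trivial
      · rintro ⟨h₁, h₂⟩ i hi
        by_cases hix : i = x
        · subst hix
          simpa [hi] using h₁
        · simpa [hix] using h₂ i ⟨hix, hi⟩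
    rw [hpre, Measure.prod_prod, Measure.infinitePi_pi _ fun i _ => ht i]
    split_ifs with hx
    · exact Finset.mul_prod_erase s (fun i => ν (t i)) hx
    · simp [Finset.erase_eq_of_notMem hx]
  conv_lhs => rw [← key]
  rw [lintegral_map hF hm]
  exact lintegral_prod _ (hF.comp hm).aemeasurable

/-- Independence: resampling the coordinates of `I` one at a time splits off one factor each. -/
theorem lintegral_infinitePi_finset_prod {w : R → ℝ≥0∞} (hw : Measurable w) (I : Finset U) :
    ∫⁻ H, ∏ x ∈ I, w (H x) ∂Measure.infinitePi (fun _ : U => ν) = (∫⁻ r, w r ∂ν) ^ I.card := by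
  classical
  induction I using Finset.induction_on with
  | empty => simp
  | insert a I ha ih =>
    have hm : ∀ J : Finset U, Measurable fun H : U → R => ∏ x ∈ J, w (H x) := fun J =>
      Finset.measurable_fun_prod _ fun x _ => hw.comp (measurable_pi_apply x)
    rw [lintegral_infinitePi_update ν (hm _) a, Finset.card_insert_of_notMem ha, pow_succ', ← ih,
      ← lintegral_mul_const _ hw]
    refine lintegral_congr fun r => ?_
    rw [← lintegral_const_mul _ (hm I)]
    refine lintegral_congr fun H => ?_
    rw [Finset.prod_insert ha, Function.update_self]
    congr 1
    refine Finset.prod_congr rfl fun x hx => ?_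
    rw [Function.update_of_ne (ne_of_mem_of_not_mem hx ha)]

end Resampling

/-! ### Adaptive oracle computations and their exponential moments. -/

namespace OracleComp

variable {U R O : Type*}

/-- The expectation, over the coins, of a function of the output and the oracle. -/
noncomputable def expect (G : O → (U → R) → ℝ≥0∞) : OracleComp U R O → (U → R) → ℝ≥0∞
  | output X, H => G X H
  | query x next, H => expect G (next (H x)) H
  | toss next, H => 2⁻¹ * (expect G (next true) H + expect G (next false) H)
  | step next, H => expect G next H

/-- Replaces the sum over outputs by a recursion along the tree, on which inductions are immediate.
-/
theorem tsum_run_mul (G : O → (U → R) → ℝ≥0∞) (A : OracleComp U R O) (H : U → R) :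
    ∑' X, A.run H X * G X H = A.expect G H := by
  classical
  induction A with
  | output X =>
    rw [tsum_eq_single X fun Y hY => by simp [run, hY]]
    simp [run, expect]
  | query x next ih => exact ih (H x)
  | toss next ih =>
    simp only [run, expect, PMF.bind_apply, ← ih, tsum_fintype, Fintype.sum_bool,
      PMF.uniformOfFintype_apply, Fintype.card_bool, add_mul, ENNReal.tsum_add, mul_add,
      ← ENNReal.tsum_mul_left, mul_assoc, Nat.cast_ofNat]
  | step next ih => exact ih

theorem expect_finset_sum {κ : Type*} (s : Finset κ) (c : κ → ℝ≥0∞)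
    (G : κ → O → (U → R) → ℝ≥0∞) (A : OracleComp U R O) (H : U → R) :
    A.expect (fun X H => ∑ j ∈ s, c j * G j X H) H = ∑ j ∈ s, c j * A.expect (G j) H := by
  simp only [← tsum_run_mul, Finset.mul_sum, ← ENNReal.tsum_mul_left]
  rw [Summable.tsum_finsetSum fun _ _ => ENNReal.summable]
  refine Finset.sum_congr rfl fun j _ => tsum_congr fun X => ?_
  ring

/-- With finitely many oracle answers, only finitely many outputs are possible. -/
theorem exists_finite_outputs [Finite R] (A : OracleComp U R O) :
    ∃ L : Set O, L.Finite ∧ ∀ H X, A.run H X ≠ 0 → X ∈ L := by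
  induction A with
  | output X =>
    refine ⟨{X}, Set.finite_singleton X, fun H Y hY => ?_⟩
    simpa [run] using hY
  | query x next ih =>
    choose L hL hX using ih
    exact ⟨⋃ r, L r, Set.finite_iUnion hL, fun H X h => Set.mem_iUnion.2 ⟨H x, hX _ H X h⟩⟩
  | toss next ih =>
    choose L hL hX using ih
    refine ⟨⋃ r, L r, Set.finite_iUnion hL, fun H X h => ?_⟩
    have h' : X ∈ ((PMF.uniformOfFintype Bool).bind fun c => run H (next c)).support := h
    obtain ⟨c, -, hc⟩ := (PMF.mem_support_bind_iff _ _ _).1 h'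
    exact Set.mem_iUnion.2 ⟨c, hX c H X hc⟩
  | step next ih => exact ih

variable [MeasurableSpace R]

/-- The oracle's answer selects the branch; as `R` is countable, measurability of every single
branch suffices. -/
theorem measurable_expect [Countable R] [MeasurableSingletonClass R]
    {G : O → (U → R) → ℝ≥0∞} (hG : ∀ X, Measurable (G X)) (A : OracleComp U R O) :
    Measurable (A.expect G) := by
  induction A with
  | output X => exact hG X
  | query x next ih =>
    have : Measurable fun p : R × (U → R) => (next p.1).expect G p.2 :=
      measurable_from_prod_countable_right ih
    have hx : Measurable fun H : U → R => (H x, H) :=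
      (measurable_pi_apply x).prodMk measurable_id
    exact this.comp hx
  | toss next ih => exact ((ih true).add (ih false)).const_mul _
  | step next ih => exact ih

open Classical in
/-- Exponential moments of the hash values at the identifiers that an adaptive computation outputs,
when the oracle is already known on `D`. -/
theorem lintegral_expect_piecewise_le [Countable R] [MeasurableSingletonClass R]
    (ν : Measure R) [IsProbabilityMeasure ν] {w : R → ℝ≥0∞} (hw : ∀ r, 1 ≤ w r)
    {I : O → Finset U} {n : ℕ} (hI : ∀ X, (I X).card ≤ n) (A : OracleComp U R O) :
    ∀ (t : ℕ), A.RunsWithin t → ∀ (D : Finset U) (g : U → R),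
      ∫⁻ H, A.expect (fun X H => ∏ x ∈ I X, w (H x)) (D.piecewise g H)
          ∂Measure.infinitePi (fun _ : U => ν) ≤
        (∏ x ∈ D, w (g x)) * (∫⁻ r, w r ∂ν) ^ (t + n) := by
  have hwm : Measurable w := measurable_of_countable w
  have hM : 1 ≤ ∫⁻ r, w r ∂ν := by
    calc (1 : ℝ≥0∞) = ∫⁻ _, 1 ∂ν := by simp
      _ ≤ _ := lintegral_mono hw
  have hwx : ∀ x : U, Measurable fun H : U → R => w (H x) := fun x =>
    hwm.comp (measurable_pi_apply x)
  have hGm : ∀ X : O, Measurable fun H : U → R => ∏ x ∈ I X, w (H x) := fun X =>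
    Finset.measurable_fun_prod _ fun x _ => hwx x
  have hpw : ∀ (D : Finset U) (g : U → R), Measurable fun H : U → R => D.piecewise g H := by
    refine fun D g => measurable_pi_lambda _ fun x => ?_
    by_cases hx : x ∈ D
    · simp [hx]
    · simpa [hx] using measurable_pi_apply x
  induction A with
  | output X =>
    intro t _ D g
    simp only [expect]
    -- Known identifiers contribute their recorded weights, the others are fresh and independent.
    -- Missing factors may be added because all weights are at least 1.
    have hsplit : ∀ H : U → R, ∏ x ∈ I X, w (D.piecewise g H x) =
        (∏ x ∈ I X ∩ D, w (g x)) * ∏ x ∈ I X \ D, w (H x) := by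
      intro H
      rw [← Finset.prod_inter_mul_prod_sdiff (I X) D]
      congr 1
      · exact Finset.prod_congr rfl fun x hx => by simp [(Finset.mem_inter.1 hx).2]
      · exact Finset.prod_congr rfl fun x hx => by simp [(Finset.mem_sdiff.1 hx).2]
    simp only [hsplit]
    rw [lintegral_const_mul _
      (Finset.measurable_fun_prod _ fun x _ => hwx x),
      lintegral_infinitePi_finset_prod ν hwm]
    refine mul_le_mul' (Finset.prod_le_prod_of_subset_of_one_le' Finset.inter_subset_right
      fun x _ _ => hw _) (pow_le_pow_right₀ hM ?_)
    have := Finset.card_le_card (Finset.sdiff_subset : I X \ D ⊆ I X)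
    have := hI X
    omega
  | query x next ih =>
    intro t ht D g
    obtain _ | t := t
    · exact ht.elim
    -- A repeated query reveals nothing. A fresh one is resampled and recorded in `D`; integrating
    -- its weight gives one more factor of the mean.
    by_cases hx : x ∈ D
    · simp only [expect, Finset.piecewise_eq_of_mem _ _ _ hx]
      exact (ih (g x) t (ht _) D g).trans
        (mul_le_mul_right (pow_le_pow_right₀ hM (by omega)) _)
    · have hF : Measurable fun H : U → R =>
          (query x next).expect (fun X H => ∏ x ∈ I X, w (H x)) (D.piecewise g H) :=
        (measurable_expect hGm (query x next)).comp (hpw D g)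
      rw [lintegral_infinitePi_update ν hF x]
      have hr : ∀ r H, D.piecewise g (Function.update H x r) =
          (insert x D).piecewise (Function.update g x r) H := by
        intro r H
        ext y
        by_cases hy : y = x
        · subst hy; simp [hx]
        · by_cases hyD : y ∈ D <;> simp [hy, hyD]
      have hxi : ∀ r H, (insert x D).piecewise (Function.update g x r) H x = r := by simp
      simp only [hr, expect, hxi]
      calc _ ≤ ∫⁻ r, (∏ y ∈ insert x D, w (Function.update g x r y)) *
              (∫⁻ r, w r ∂ν) ^ (t + n) ∂ν := lintegral_mono fun r => ih r t (ht r) _ _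
        _ = ∫⁻ r, w r * ((∏ y ∈ D, w (g y)) * (∫⁻ r, w r ∂ν) ^ (t + n)) ∂ν := by
          refine lintegral_congr fun r => ?_
          rw [Finset.prod_insert hx, Function.update_self, mul_assoc]
          congr 2
          exact Finset.prod_congr rfl fun y hy => by
            rw [Function.update_of_ne (ne_of_mem_of_not_mem hy hx)]
        _ = _ := by
          rw [lintegral_mul_const _ hwm]
          ring
  | toss next ih =>
    intro t ht D g
    obtain _ | t := t
    · exact ht.elim
    simp only [expect]
    have hm : ∀ c, Measurable fun H : U → R =>
        (next c).expect (fun X H => ∏ x ∈ I X, w (H x)) (D.piecewise g H) := fun c =>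
      (measurable_expect hGm (next c)).comp (hpw D g)
    rw [lintegral_const_mul _ ((hm true).fun_add (hm false)), lintegral_add_left (hm true)]
    have hB : ∀ c, ∫⁻ H, (next c).expect (fun X H => ∏ x ∈ I X, w (H x)) (D.piecewise g H)
        ∂Measure.infinitePi (fun _ : U => ν) ≤
          (∏ x ∈ D, w (g x)) * (∫⁻ r, w r ∂ν) ^ (t + 1 + n) := fun c =>
      (ih c t (ht c) D g).trans (mul_le_mul_right (pow_le_pow_right₀ hM (by omega)) _)
    calc _ ≤ 2⁻¹ * ((∏ x ∈ D, w (g x)) * (∫⁻ r, w r ∂ν) ^ (t + 1 + n) +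
          (∏ x ∈ D, w (g x)) * (∫⁻ r, w r ∂ν) ^ (t + 1 + n)) :=
        mul_le_mul_right (add_le_add (hB true) (hB false)) _
      _ = _ := by
        rw [← two_mul, ← mul_assoc, ENNReal.inv_mul_cancel two_ne_zero ENNReal.ofNat_ne_top,
          one_mul]
  | step next ih =>
    intro t ht D g
    obtain _ | t := t
    · exact ht.elim
    exact (ih t ht D g).trans (mul_le_mul_right (pow_le_pow_right₀ hM (by omega)) _)

theorem lintegral_expect_prod_le [Countable R] [MeasurableSingletonClass R]
    (ν : Measure R) [IsProbabilityMeasure ν] {w : R → ℝ≥0∞} (hw : ∀ r, 1 ≤ w r)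
    {I : O → Finset U} {n : ℕ} (hI : ∀ X, (I X).card ≤ n) {A : OracleComp U R O} {t : ℕ}
    (ht : A.RunsWithin t) :
    ∫⁻ H, A.expect (fun X H => ∏ x ∈ I X, w (H x)) H ∂Measure.infinitePi (fun _ : U => ν) ≤
      (∫⁻ r, w r ∂ν) ^ (t + n) := by
  by_cases hne : Nonempty R
  · obtain ⟨r₀⟩ := hne
    simpa using lintegral_expect_piecewise_le ν hw hI A t ht ∅ fun _ => r₀
  · have : IsEmpty R := not_nonempty_iff.1 hne
    exact absurd (measure_univ (μ := ν)) (by simp [Set.eq_empty_of_isEmpty])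

end OracleComp

/-! ### Confined hash values and Hall's theorem. -/

namespace Cuckoo

/-- Increasing `b` by one shifts the window of summation: `b / k` leaves and `(b + k) / k = b / k +
1` enters. -/
theorem sum_range_add_div (k b : ℕ) (hk : 0 < k) : ∑ i ∈ Finset.range k, (b + i) / k = b := by
  induction b with
  | zero =>
    refine Finset.sum_eq_zero fun i hi => ?_
    rw [zero_add, Nat.div_eq_of_lt (Finset.mem_range.1 hi)]
  | succ b ih =>
    have h₁ := Finset.sum_range_succ (fun i => (b + i) / k) k
    rw [Finset.sum_range_succ'] at h₁
    have h₂ : ∑ i ∈ Finset.range k, (b + 1 + i) / k = ∑ i ∈ Finset.range k, (b + (i + 1)) / k :=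
      Finset.sum_congr rfl fun i _ => by rw [add_assoc, add_comm 1 i]
    rw [Nat.add_div_right b hk, ih, add_zero] at h₁
    omega

theorem sum_subtableSize {k : ℕ} (b : ℕ) (hk : 0 < k) : ∑ i, subtableSize k b i = b := by
  simp only [subtableSize]
  rw [Fin.sum_univ_eq_sum_range fun i => (b + i) / k, sum_range_add_div k b hk]

theorem subtableSize_pos {k b : ℕ} (h : k ≤ b) (i : Fin k) : 0 < subtableSize k b i :=
  Nat.div_pos (h.trans (Nat.le_add_right b i)) (i.val.zero_le.trans_lt i.isLt)

theorem subtableSize_le {k b : ℕ} (h : k ≤ b) (i : Fin k) :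
    (subtableSize k b i : ℝ) ≤ 2 * b / k := by
  have hk : (0 : ℝ) < k := by exact_mod_cast i.val.zero_le.trans_lt i.isLt
  rw [le_div_iff₀ hk]
  have : subtableSize k b i * k ≤ 2 * b :=
    (Nat.div_mul_le_self _ _).trans (by have := i.isLt; omega)
  exact_mod_cast this

/-- The entries of the sub-tables. -/
abbrev Entry (k b : ℕ) := (i : Fin k) × Fin (subtableSize k b i)

/-- All the entries selected by `h` belong to `S`. -/
def Confined {k b : ℕ} (S : Finset (Entry k b)) (h : HashValue k b) : Prop :=
  ∀ i, (⟨i, h i⟩ : Entry k b) ∈ S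

theorem card_entry {k : ℕ} (b : ℕ) (hk : 0 < k) : Fintype.card (Entry k b) = b := by
  simp [Fintype.card_sigma, sum_subtableSize b hk]

open Classical in
/-- The entries of `S` in the `i`-th sub-table. -/
noncomputable def slice {k b : ℕ} (S : Finset (Entry k b)) (i : Fin k) :
    Finset (Fin (subtableSize k b i)) :=
  Finset.univ.filter fun j => (⟨i, j⟩ : Entry k b) ∈ S

theorem sum_card_slice {k b : ℕ} (S : Finset (Entry k b)) :
    ∑ i, (slice S i).card = S.card := by
  rw [← Finset.card_sigma]
  congr 1
  ext ⟨i, j⟩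
  simp [slice]

open Classical in
theorem card_confined {k b : ℕ} (S : Finset (Entry k b)) :
    (Finset.univ.filter fun h : HashValue k b => Confined S h).card =
      ∏ i, (slice S i).card := by
  rw [← Fintype.card_piFinset]
  congr 1
  ext h
  rw [Finset.mem_filter, Fintype.mem_piFinset]
  simp [Confined, slice]

/-- Hash values that are confined to a proper fraction of the entries are exponentially rare. -/
theorem card_confined_div_le {k b : ℕ} (hkb : k ≤ b) (hk : 0 < k) (S : Finset (Entry k b))
    {α : ℝ} (hα : 0 < α) (hS : α * S.card ≤ b) :
    ∏ i, ((slice S i).card : ℝ) / subtableSize k b i ≤ Real.exp (-((1 - 1 / α) / 2 * k)) := by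
  have hk' : (0 : ℝ) < k := by exact_mod_cast hk
  have hb' : (0 : ℝ) < b := by exact_mod_cast hk.trans_le hkb
  have hle : ∀ i, ((slice S i).card : ℝ) ≤ subtableSize k b i := fun i => by
    exact_mod_cast (Finset.card_le_univ _).trans_eq (Fintype.card_fin _)
  -- This is `1 - u ≤ exp (-u)`, followed by the uniform bound `2b/k` on the sub-table sizes, so
  -- that the exponents add up to a function of `S.card` alone.
  have hstep : ∀ i, ((slice S i).card : ℝ) / subtableSize k b i ≤
      Real.exp (-((subtableSize k b i - (slice S i).card) * (k / (2 * b)))) := by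
    intro i
    have hpos : (0 : ℝ) < subtableSize k b i := by exact_mod_cast subtableSize_pos hkb i
    have h₁ : ((slice S i).card : ℝ) / subtableSize k b i =
        -((subtableSize k b i - (slice S i).card) / subtableSize k b i) + 1 := by
      field_simp
      ring
    rw [h₁]
    refine (Real.add_one_le_exp _).trans (Real.exp_le_exp.2 (neg_le_neg ?_))
    rw [div_eq_mul_inv _ (subtableSize k b i : ℝ)]
    refine mul_le_mul_of_nonneg_left ?_ (sub_nonneg.2 (hle i))
    rw [← inv_div]
    exact inv_anti₀ hpos (subtableSize_le hkb i)
  refine (Finset.prod_le_prod (fun i _ => by positivity) fun i _ => hstep i).trans ?_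
  rw [← Real.exp_sum, Finset.sum_neg_distrib, ← Finset.sum_mul, Finset.sum_sub_distrib]
  have e₁ : ∑ i, (subtableSize k b i : ℝ) = b := by exact_mod_cast sum_subtableSize b hk
  have e₂ : ∑ i, ((slice S i).card : ℝ) = S.card := by exact_mod_cast sum_card_slice S
  rw [e₁, e₂]
  refine Real.exp_le_exp.2 (neg_le_neg ?_)
  have h₃ : (S.card : ℝ) ≤ b / α := (le_div_iff₀ hα).2 (by linarith)
  calc (1 - 1 / α) / 2 * k = (b - b / α) * (k / (2 * b)) := by field_simp
    _ ≤ _ := by gcongr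

open Classical in
theorem toMeasure_confined_le {k b : ℕ} (hkb : k ≤ b) (hk : 0 < k) [Nonempty (HashValue k b)]
    (S : Finset (Entry k b)) {α : ℝ} (hα : 0 < α) (hS : α * S.card ≤ b) :
    (PMF.uniformOfFintype (HashValue k b)).toMeasure {h | Confined S h} ≤
      ENNReal.ofReal (Real.exp (-((1 - 1 / α) / 2 * k))) := by
  rw [PMF.toMeasure_uniformOfFintype_apply _ (Set.toFinite _).measurableSet]
  refine le_trans (le_of_eq ?_)
    (ENNReal.ofReal_le_ofReal (card_confined_div_le hkb hk S hα hS))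
  have hpos : ∀ i, (0 : ℝ) < subtableSize k b i := fun i => by
    exact_mod_cast subtableSize_pos hkb i
  rw [Finset.prod_div_distrib, ENNReal.ofReal_div_of_pos (Finset.prod_pos fun i _ => hpos i)]
  congr 1
  · rw [Fintype.card_subtype]
    simp only [Set.mem_ofPred_eq]
    rw [card_confined, ← Nat.cast_prod, ENNReal.ofReal_natCast]
  · rw [Fintype.card_pi, ← Nat.cast_prod, ENNReal.ofReal_natCast]
    simp

open Classical in
/-- Hall's theorem: items that cannot be allocated hash into too few entries. -/
theorem exists_confined_of_not_isAllocation {n k b : ℕ} {U V : Type*} {H : U → HashValue k b}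
    {X : Finset (U × V)} (hX : IsItemSet n X)
    (hT : ¬ ∃ T : Table k b 1 0 U V, IsAllocation H X T) :
    ∃ S : Finset (Entry k b), S.card < n ∧
      S.card + 1 ≤ ((X.image Prod.fst).filter fun x => Confined S (H x)).card := by
  let t : X → Finset (Entry k b) := fun x => Finset.univ.image fun i => ⟨i, H x.1.1 i⟩
  have ht : ∀ (x : X) (e : Entry k b), e ∈ t x →
      ∀ j, Allowed (l := 1) (s := 0) (H x.1.1) (Sum.inl (e, j)) := by
    intro x e he j
    obtain ⟨i, -, rfl⟩ := Finset.mem_image.1 he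
    rfl
  -- As `l = 1`, a system of distinct representatives is the same as an allocation.
  have hno : ¬ ∃ F : X → Entry k b, Function.Injective F ∧ ∀ x, F x ∈ t x := by
    rintro ⟨F, hF, hFt⟩
    refine hT ⟨fun p => match p with
      | Sum.inl (e, _) => if h : ∃ x : X, F x = e then some h.choose.1 else none
      | Sum.inr _ => none, ?_, ?_⟩
    · rintro (⟨e, j⟩ | p) x hx
      · simp only at hx
        split_ifs at hx with h
        obtain rfl := Option.some.inj hx
        refine ⟨h.choose.2, ht _ e ?_ j⟩
        have hm := hFt h.choose
        rwa [h.choose_spec] at hm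
      · simp at hx
    · intro x hx
      have hex : ∃ y : X, F y = F ⟨x, hx⟩ := ⟨⟨x, hx⟩, rfl⟩
      have hch : hex.choose = ⟨x, hx⟩ := hF hex.choose_spec
      refine ⟨Sum.inl (F ⟨x, hx⟩, 0), ?_, ?_⟩
      · simp only [dif_pos hex, hch]
      · rintro (⟨e, j⟩ | p) hp
        · simp only at hp
          split_ifs at hp with h
          have hc : h.choose = ⟨x, hx⟩ := Subtype.ext (Option.some.inj hp)
          have he := h.choose_spec
          rw [hc] at he
          rw [he, Subsingleton.elim j 0]
        · exact p.elim0
  rw [← Finset.all_card_le_biUnion_card_iff_exists_injective] at hno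
  push Not at hno
  obtain ⟨Y, hY⟩ := hno
  have hYn : Y.card ≤ n := by
    simpa [hX.1] using Finset.card_le_univ Y
  refine ⟨Y.biUnion t, hY.trans_le hYn, (Nat.succ_le_of_lt hY).trans ?_⟩
  refine Finset.card_le_card_of_injOn (fun x => x.1.1) (fun x hx => ?_) ?_
  · simp only [Finset.coe_filter, Set.mem_ofPred_eq, Finset.mem_image]
    refine ⟨⟨x.1, x.2, rfl⟩, fun i => Finset.mem_biUnion.2 ⟨x, hx, ?_⟩⟩
    exact Finset.mem_image.2 ⟨i, Finset.mem_univ i, rfl⟩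
  · intro x _ y _ hxy
    exact Subtype.ext (hX.2 x.2 y.2 hxy)

/-! ### The union bound over sets of entries. -/

open Classical in
/-- The weight by which a hash value contributes to the exponential moment for `S`. -/
noncomputable def weight {k b : ℕ} (z : ℝ≥0∞) (S : Finset (Entry k b)) (h : HashValue k b) :
    ℝ≥0∞ :=
  if Confined S h then z else 1

open Classical in
theorem lintegral_weight_le {k b : ℕ} (μ : Measure (HashValue k b)) [IsProbabilityMeasure μ]
    (z : ℝ≥0∞) (S : Finset (Entry k b)) :
    ∫⁻ h, weight z S h ∂μ ≤ 1 + z * μ {h | Confined S h} := by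
  have hm : MeasurableSet {h : HashValue k b | Confined S h} := (Set.toFinite _).measurableSet
  calc ∫⁻ h, weight z S h ∂μ
      ≤ ∫⁻ h, 1 + {h | Confined S h}.indicator (fun _ => z) h ∂μ := by
        refine lintegral_mono fun h => ?_
        by_cases hc : Confined S h <;> simp [weight, hc]
    _ = 1 + z * μ {h | Confined S h} := by
        rw [lintegral_add_left measurable_const, lintegral_indicator_const hm]
        simp

open Classical in
/-- The failure indicator is at most a sum of exponential moments. -/
theorem one_le_sum_weight {n k b : ℕ} {U V : Type*} {H : U → HashValue k b}
    {X : Finset (U × V)} (hX : IsItemSet n X)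
    (hT : ¬ ∃ T : Table k b 1 0 U V, IsAllocation H X T) {y : ℝ≥0∞} (hy : y ≤ 1) (hy0 : y ≠ 0) :
    1 ≤ ∑ S ∈ Finset.univ.filter (fun S : Finset (Entry k b) => S.card < n),
      y ^ (S.card + 1) * ∏ x ∈ X.image Prod.fst, weight y⁻¹ S (H x) := by
  obtain ⟨S, hSn, hS⟩ := exists_confined_of_not_isAllocation hX hT
  refine le_trans ?_ (Finset.single_le_sum
    (f := fun S : Finset (Entry k b) => y ^ (S.card + 1) *
      ∏ x ∈ X.image Prod.fst, weight y⁻¹ S (H x)) (fun _ _ => zero_le)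
    (Finset.mem_filter.2 ⟨Finset.mem_univ S, hSn⟩))
  have hyt : y ≠ ⊤ := (hy.trans_lt ENNReal.one_lt_top).ne
  simp only [weight, Finset.prod_ite, Finset.prod_const, one_pow, mul_one]
  -- At least `S.card + 1` identifiers carry the weight `y⁻¹ ≥ 1`, which cancels the prefactor.
  calc (1 : ℝ≥0∞) = y ^ (S.card + 1) * y⁻¹ ^ (S.card + 1) := by
        rw [← mul_pow, ENNReal.mul_inv_cancel hy0 hyt, one_pow]
    _ ≤ _ := mul_le_mul_right (pow_le_pow_right₀ (ENNReal.one_le_inv.2 hy) hS) _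

-- Expected value of the sum in `one_le_sum_weight`; the parameter `y` stays free for later
-- optimization.
open Classical in
theorem failProb_le {n k b : ℕ} {U V : Type*} (hkb : k ≤ b) (hk : 0 < k)
    (K : Construction n k b 1 0 U V) (hK : (CH hkb K).IsPerfect) {α : ℝ} (hα : 0 < α)
    (hb : α * n ≤ b) (A : (CH hkb K).Adversary) {t : ℕ} (hA : A.RunsWithin t)
    {y : ℝ≥0∞} (hy : y ≤ 1) (hy0 : y ≠ 0) :
    (CH hkb K).failProb A ≤ y * (1 + y) ^ b *
      (1 + y⁻¹ * ENNReal.ofReal (Real.exp (-((1 - 1 / α) / 2 * k)))) ^ (t + n) := by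
  have := hashValue_nonempty hkb
  set ν := (PMF.uniformOfFintype (HashValue k b)).toMeasure with hν
  have hsample : (CH hkb K).sample = Measure.infinitePi fun _ : U => ν := rfl
  let A' : OracleComp U (HashValue k b) (Finset (U × V)) := A
  -- Outputs that are not item sets get no identifiers, so that the bound `n` holds for every
  -- output.
  let I : Finset (U × V) → Finset U := fun X => if IsItemSet n X then X.image Prod.fst else ∅
  have hI : ∀ X, (I X).card ≤ n := by
    intro X
    by_cases hX : IsItemSet n X
    · simp only [I, if_pos hX]
      exact Finset.card_image_le.trans hX.1.le
    · simp [I, hX]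
  set 𝒮 := Finset.univ.filter (fun S : Finset (Entry k b) => S.card < n) with h𝒮
  let G : Finset (Entry k b) → Finset (U × V) → (U → HashValue k b) → ℝ≥0∞ :=
    fun S X H => ∏ x ∈ I X, weight y⁻¹ S (H x)
  have hw : ∀ (S : Finset (Entry k b)) h, 1 ≤ weight y⁻¹ S h := by
    intro S h
    by_cases hc : Confined S h
    · simpa [weight, hc] using hy
    · simp [weight, hc]
  have hcard := card_entry b hk
  set p := ENNReal.ofReal (Real.exp (-((1 - 1 / α) / 2 * k))) with hp
  -- Perfection has a null set for each fixed `X`, whereas the adversary's `X` depends on `H`.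
  -- Finitely many possible outputs allow a common null set.
  obtain ⟨L, hL, hLA⟩ := A'.exists_finite_outputs
  have hae : ∀ᵐ H ∂(Measure.infinitePi fun _ : U => ν), ∀ X ∈ L, IsItemSet n X →
      (∃ T : Table k b 1 0 U V, IsAllocation H X T) → K.run H X none = 0 := by
    refine (ae_ball_iff hL.countable).2 fun X _ => ?_
    by_cases hX : IsItemSet n X
    · filter_upwards [hK X hX] with H hH _ using hH
    · exact Eventually.of_forall fun H h => absurd h hX
  have hpoint : ∀ᵐ H ∂(Measure.infinitePi fun _ : U => ν),
      ∑' X, A'.run H X * (if IsItemSet n X then K.run H X none else 0) ≤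
        ∑ S ∈ 𝒮, y ^ (S.card + 1) * A'.expect (G S) H := by
    filter_upwards [hae] with H hH
    rw [← OracleComp.expect_finset_sum, ← OracleComp.tsum_run_mul]
    refine ENNReal.tsum_le_tsum fun X => ?_
    by_cases hXL : A'.run H X = 0
    · simp [hXL]
    refine mul_le_mul_right ?_ _
    split_ifs with hX
    · by_cases hT : ∃ T : Table k b 1 0 U V, IsAllocation H X T
      · rw [hH X (hLA H X hXL) hX hT]
        exact zero_le
      · refine (PMF.coe_le_one _ _).trans ?_
        simpa only [G, I, if_pos hX] using one_le_sum_weight hX hT hy hy0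
    · exact zero_le
  have hmeas : ∀ S, Measurable (A'.expect (G S)) := fun S =>
    OracleComp.measurable_expect (fun X => Finset.measurable_fun_prod _ fun x _ =>
      (measurable_of_countable (weight y⁻¹ S)).comp (measurable_pi_apply x)) A'
  calc (CH hkb K).failProb A
      ≤ ∫⁻ H, ∑ S ∈ 𝒮, y ^ (S.card + 1) * A'.expect (G S) H
          ∂(Measure.infinitePi fun _ : U => ν) := lintegral_mono_ae hpoint
    _ = ∑ S ∈ 𝒮, y ^ (S.card + 1) * ∫⁻ H, A'.expect (G S) H
          ∂(Measure.infinitePi fun _ : U => ν) := by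
        rw [lintegral_finsetSum _ fun S _ => (hmeas S).const_mul _]
        exact Finset.sum_congr rfl fun S _ => lintegral_const_mul _ (hmeas S)
    _ ≤ ∑ S ∈ 𝒮, y ^ (S.card + 1) * (1 + y⁻¹ * p) ^ (t + n) := by
        refine Finset.sum_le_sum fun S hS => mul_le_mul_right ?_ _
        refine (OracleComp.lintegral_expect_prod_le ν (hw S) hI hA).trans ?_
        refine pow_le_pow_left₀ zero_le ((lintegral_weight_le ν y⁻¹ S).trans ?_) _
        gcongr
        refine toMeasure_confined_le hkb hk S hα (le_trans ?_ hb)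
        have : (S.card : ℝ) ≤ n := by exact_mod_cast (Finset.mem_filter.1 hS).2.le
        gcongr
    -- Without the size restriction the sum over `S` is the binomial expansion of `y(1+y)^b`.
    _ ≤ ∑ S : Finset (Entry k b), y ^ (S.card + 1) * (1 + y⁻¹ * p) ^ (t + n) :=
        Finset.sum_le_sum_of_subset (Finset.subset_univ _)
    _ = y * (1 + y) ^ b * (1 + y⁻¹ * p) ^ (t + n) := by
        rw [← Finset.sum_mul]
        congr 1
        have := Fintype.sum_pow_mul_eq_add_pow (Entry k b) y 1
        rw [hcard] at this
        simp only [one_pow, mul_one] at this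
        rw [add_comm 1 y, ← this, Finset.mul_sum]
        exact Finset.sum_congr rfl fun S _ => pow_succ' _ _

end Cuckoo

/-! ### Polynomial growth against `n ^ f n`. -/

/-- `g` is bounded by a power of its argument. -/
def PowerBounded (g : ℕ → ℕ) : Prop :=
  ∃ d : ℕ, ∀ n, 2 ≤ n → g n ≤ n ^ d

namespace PowerBounded

theorem const (a : ℕ) : PowerBounded fun _ => a :=
  -- `a < 2 ^ a ≤ n ^ a`; starting at `n = 2` lets exponents absorb constants.
  ⟨a, fun _ hn => Nat.lt_two_pow_self.le.trans (Nat.pow_le_pow_left hn a)⟩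

theorem id : PowerBounded fun n => n := ⟨1, fun n _ => by simp⟩

theorem add {g h : ℕ → ℕ} (hg : PowerBounded g) (hh : PowerBounded h) :
    PowerBounded fun n => g n + h n := by
  obtain ⟨d, hd⟩ := hg
  obtain ⟨e, he⟩ := hh
  refine ⟨max d e + 1, fun n hn => ?_⟩
  have h₁ : n ^ d ≤ n ^ max d e := Nat.pow_le_pow_right (by omega) (le_max_left _ _)
  have h₂ : n ^ e ≤ n ^ max d e := Nat.pow_le_pow_right (by omega) (le_max_right _ _)
  calc g n + h n ≤ n ^ max d e * 2 := by linarith [hd n hn, he n hn]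
    _ ≤ n ^ (max d e + 1) := by rw [pow_succ]; exact Nat.mul_le_mul_left _ hn

theorem mul {g h : ℕ → ℕ} (hg : PowerBounded g) (hh : PowerBounded h) :
    PowerBounded fun n => g n * h n := by
  obtain ⟨d, hd⟩ := hg
  obtain ⟨e, he⟩ := hh
  refine ⟨d + e, fun n hn => ?_⟩
  rw [pow_add]
  exact Nat.mul_le_mul (hd n hn) (he n hn)

theorem eval (t : MvPolynomial (Fin 2) ℕ) :
    PowerBounded fun n => MvPolynomial.eval ![n, n] t := by
  induction t using MvPolynomial.induction_on with
  | C a => simpa using const a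
  | add p q hp hq => simpa using hp.add hq
  | mul_X p i hp =>
    have hi : ∀ n : ℕ, (![n, n] : Fin 2 → ℕ) i = n := fun n => by fin_cases i <;> rfl
    simpa [hi] using hp.mul id

theorem eventually_le_rpow {g : ℕ → ℕ} (hg : PowerBounded g) {f : ℕ → ℝ}
    (hf : Tendsto f atTop atTop) : ∀ᶠ n : ℕ in atTop, (g n : ℝ) ≤ (n : ℝ) ^ f n := by
  obtain ⟨d, hd⟩ := hg
  filter_upwards [eventually_ge_atTop 2, hf.eventually_ge_atTop (d : ℝ)] with n hn hfn
  have h1 : (1 : ℝ) ≤ n := by exact_mod_cast (by omega : 1 ≤ n)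
  calc (g n : ℝ) ≤ (n : ℝ) ^ d := by exact_mod_cast hd n hn
    _ = (n : ℝ) ^ (d : ℝ) := (Real.rpow_natCast _ _).symm
    _ ≤ _ := Real.rpow_le_rpow_of_exponent_le h1 hfn

end PowerBounded

theorem isNegligible_rpow_neg {f : ℕ → ℝ} (hf : Tendsto f atTop atTop) :
    IsNegligible fun n => (n : ℝ) ^ (-f n) := by
  intro c
  have hlim : Tendsto (fun n : ℕ => ((n : ℝ))⁻¹) atTop (nhds 0) :=
    tendsto_inv_atTop_zero.comp tendsto_natCast_atTop_atTop
  refine squeeze_zero' (Eventually.of_forall fun n => by positivity) ?_ hlim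
  filter_upwards [eventually_ge_atTop 1, hf.eventually_ge_atTop ((c : ℝ) + 1)] with n hn hfn
  have h1 : (1 : ℝ) ≤ n := by exact_mod_cast hn
  rw [← Real.rpow_natCast, ← Real.rpow_add (by linarith), ← Real.rpow_neg_one]
  exact Real.rpow_le_rpow_of_exponent_le h1 (by linarith)

/-! ### Choice of parameters and conclusion. -/

namespace Cuckoo

theorem one_add_pow_le_ofReal_exp {x : ℝ} (hx : 0 ≤ x) {m : ℕ} (h : x * m ≤ 1) :
    (1 + ENNReal.ofReal x) ^ m ≤ ENNReal.ofReal (Real.exp 1) := by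
  rw [← ENNReal.ofReal_one, ← ENNReal.ofReal_add zero_le_one hx,
    ← ENNReal.ofReal_pow (by positivity)]
  refine ENNReal.ofReal_le_ofReal ?_
  calc (1 + x) ^ m ≤ Real.exp x ^ m := by
        gcongr
        rw [add_comm]
        exact Real.add_one_le_exp x
    _ = Real.exp (m * x) := (Real.exp_nat_mul x m).symm
    _ ≤ Real.exp 1 := Real.exp_le_exp.2 (by linarith)

/-- The choice `y = p(t+n)` makes `p/y` the reciprocal of `t+n`, while `hpb` says `yb ≤ 1`; each
power is then at most `e`, and `e² ≤ 9`. -/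
theorem failProb_le_of_exp_le {n k b : ℕ} {U V : Type*} (hkb : k ≤ b) (hk : 0 < k)
    (K : Construction n k b 1 0 U V) (hK : (CH hkb K).IsPerfect) {α : ℝ} (hα : 0 < α)
    (hb : α * n ≤ b) (A : (CH hkb K).Adversary) {t : ℕ} (hA : A.RunsWithin t) (hn : 0 < n)
    {p : ℝ} (hp : Real.exp (-((1 - 1 / α) / 2 * k)) ≤ p)
    (hpb : p * (((t + n : ℕ) : ℝ) * b) ≤ 1) :
    (CH hkb K).failProb A ≤ ENNReal.ofReal (9 * (p * (t + n : ℕ))) := by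
  have hp0 : 0 < p := (Real.exp_pos _).trans_le hp
  have hQ : (0 : ℝ) < (t + n : ℕ) := by exact_mod_cast (by omega : 0 < t + n)
  have hb1 : (1 : ℝ) ≤ b := by exact_mod_cast (hk.trans_le hkb : 1 ≤ b)
  set Q : ℝ := ((t + n : ℕ) : ℝ) with hQdef
  have hy0 : 0 < p * Q := by positivity
  have hy1 : p * Q ≤ 1 := by nlinarith
  have hE : Real.exp 1 * Real.exp 1 ≤ 9 := by
    nlinarith [Real.exp_one_lt_three, Real.exp_pos 1]
  refine (failProb_le hkb hk K hK hα hb A hA (y := ENNReal.ofReal (p * Q))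
    (ENNReal.ofReal_le_one.2 hy1) (ENNReal.ofReal_pos.2 hy0).ne').trans ?_
  have h₁ : (1 + ENNReal.ofReal (p * Q)) ^ b ≤ ENNReal.ofReal (Real.exp 1) :=
    one_add_pow_le_ofReal_exp hy0.le (by rwa [mul_assoc])
  have h₂ : (1 + (ENNReal.ofReal (p * Q))⁻¹ *
      ENNReal.ofReal (Real.exp (-((1 - 1 / α) / 2 * k)))) ^ (t + n) ≤
        ENNReal.ofReal (Real.exp 1) := by
    rw [← ENNReal.ofReal_inv_of_pos hy0, ← ENNReal.ofReal_mul (by positivity)]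
    refine one_add_pow_le_ofReal_exp (by positivity) ?_
    calc (p * Q)⁻¹ * Real.exp (-((1 - 1 / α) / 2 * k)) * (t + n : ℕ)
        ≤ (p * Q)⁻¹ * p * Q := by gcongr
      _ = 1 := by field_simp
  calc _ ≤ ENNReal.ofReal (p * Q) * ENNReal.ofReal (Real.exp 1) * ENNReal.ofReal (Real.exp 1) := by
        gcongr
    _ = ENNReal.ofReal (p * Q * (Real.exp 1 * Real.exp 1)) := by
        rw [← ENNReal.ofReal_mul hy0.le, ← ENNReal.ofReal_mul (by positivity), mul_assoc]
    _ ≤ _ := ENNReal.ofReal_le_ofReal (by nlinarith)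

/-- Cuckoo hashing with `⌈α n⌉` entries is robust as soon as the number of hash functions exceeds
`f n * log n` by a constant factor. -/
theorem isStronglyRobust_CH {α : ℝ} (hα : 1 < α) {U V : ℕ → Type*} {f : ℕ → ℝ}
    (hf : Tendsto f atTop atTop) {k : ℕ → ℕ} (hkb : ∀ n : ℕ, k n ≤ ⌈α * n⌉₊)
    (K : ∀ n : ℕ, Construction n (k n) ⌈α * n⌉₊ 1 0 (U n) (V n))
    (hK : ∀ n : ℕ, (CH (hkb n) (K n)).IsPerfect)
    (hk : ∀ᶠ n : ℕ in atTop, 4 / (1 - 1 / α) * (f n * Real.log n) ≤ k n) :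
    IsStronglyRobust (fun n => CH (hkb n) (K n)) (fun n => n) (fun n => (n : ℝ) ^ (-f n)) := by
  intro t A c hA
  have hc : 0 < 1 - 1 / α := sub_pos.2 ((div_lt_one (by linarith)).2 hα)
  have hQ : PowerBounded fun n => c * MvPolynomial.eval ![n, n] t + n :=
    ((PowerBounded.const c).mul (PowerBounded.eval t)).add PowerBounded.id
  have hb : PowerBounded fun n => ⌈α * n⌉₊ := by
    obtain ⟨d, hd⟩ := (PowerBounded.const ⌈α⌉₊).mul PowerBounded.id
    refine ⟨d, fun n hn => le_trans (Nat.ceil_le.2 ?_) (hd n hn)⟩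
    push_cast
    gcongr
    exact Nat.le_ceil α
  filter_upwards [hA, hk, (hQ.mul hb).eventually_le_rpow hf,
    ((PowerBounded.const 9).mul hQ).eventually_le_rpow hf, hf.eventually_ge_atTop 1,
    eventually_ge_atTop 2] with n hAn hkn hQb h9Q hfn hn
  have hn1 : (1 : ℝ) < n := by exact_mod_cast (by omega : 1 < n)
  have hn0 : (0 : ℝ) < n := by linarith
  have hlog : 0 < Real.log n := Real.log_pos hn1
  have hkpos : 0 < k n := by
    have : 0 < 4 / (1 - 1 / α) * (f n * Real.log n) := by positivity
    exact_mod_cast this.trans_le hkn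
  -- The constant 4 cancels the 2 in the exponent and leaves `n ^ (-2 f n)`.
  have hexp : Real.exp (-((1 - 1 / α) / 2 * k n)) ≤ (n : ℝ) ^ (-f n) * (n : ℝ) ^ (-f n) := by
    rw [← Real.rpow_add hn0, Real.rpow_def_of_pos hn0]
    refine Real.exp_le_exp.2 ?_
    have : (1 - 1 / α) / 2 * (4 / (1 - 1 / α) * (f n * Real.log n)) ≤ (1 - 1 / α) / 2 * k n := by
      gcongr
    have h2 : (1 - 1 / α) / 2 * (4 / (1 - 1 / α) * (f n * Real.log n)) =
        2 * (f n * Real.log n) := by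
      have := hc.ne'
      generalize 1 - 1 / α = γ at this
      field_simp
      ring
    linarith
  have hinv : (n : ℝ) ^ (-f n) * (n : ℝ) ^ f n = 1 := by
    rw [← Real.rpow_add hn0]
    simp
  have hle1 : (n : ℝ) ^ (-f n) ≤ 1 := Real.rpow_le_one_of_one_le_of_nonpos hn1.le (by linarith)
  have hpos : 0 < (n : ℝ) ^ (-f n) := by positivity
  push_cast at hQb h9Q
  refine (failProb_le_of_exp_le (hkb n) hkpos (K n) (hK n) (by linarith) (Nat.le_ceil _) (A n) hAn
    (by omega) hexp ?_).trans (ENNReal.ofReal_le_ofReal ?_)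
  · push_cast
    calc _ ≤ (n : ℝ) ^ (-f n) * (n : ℝ) ^ (-f n) * (n : ℝ) ^ f n := by gcongr
      _ ≤ 1 := by rw [mul_assoc, hinv, mul_one]; exact hle1
  · push_cast
    calc _ = (n : ℝ) ^ (-f n) * ((n : ℝ) ^ (-f n) *
          (9 * (c * (MvPolynomial.eval ![n, n] t : ℕ) + n))) := by ring
      _ ≤ (n : ℝ) ^ (-f n) * ((n : ℝ) ^ (-f n) * (n : ℝ) ^ f n) := by gcongr
      _ = _ := by rw [hinv, mul_one]

end Cuckoo

theorem mainTheorem6 (α : ℝ) (hα : 1 < α) :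
    ∃ C : ℝ, 0 < C ∧
      ∀ (U V : ℕ → Type*) (f : ℕ → ℝ) (_ : Tendsto f atTop atTop)
        (k : ℕ → ℕ) (hkb : ∀ n : ℕ, k n ≤ ⌈α * n⌉₊)
        (K : ∀ n : ℕ, Cuckoo.Construction n (k n) ⌈α * n⌉₊ 1 0 (U n) (V n))
        (_ : ∀ n : ℕ, (Cuckoo.CH (hkb n) (K n)).IsPerfect),
        IsNegligible (fun n => (n : ℝ) ^ (-f n)) ∧
        ((∀ᶠ n : ℕ in atTop, C * (f n * Real.log n) ≤ k n) →
          IsStronglyRobust (fun n => Cuckoo.CH (hkb n) (K n)) (fun n => n)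
            (fun n => (n : ℝ) ^ (-f n))) ∧
        ((fun n : ℕ => f n * Real.log n) =O[atTop] (fun n => (k n : ℝ)) →
          ∃ ν : ℕ → ℝ, IsNegligible ν ∧
            IsStronglyRobust (fun n => Cuckoo.CH (hkb n) (K n)) (fun n => n) ν) := by
  have hc : 0 < 1 - 1 / α := sub_pos.2 ((div_lt_one (by linarith)).2 hα)
  have hC : 0 < 4 / (1 - 1 / α) := by positivity
  refine ⟨4 / (1 - 1 / α), hC, fun U V f hf k hkb K hK => ⟨isNegligible_rpow_neg hf,
    Cuckoo.isStronglyRobust_CH hα hf hkb K hK, fun hO => ?_⟩⟩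
  obtain ⟨D, hD, hbound⟩ := hO.exists_pos
  -- The implied constant `D` is absorbed by rescaling `f`, which still tends to infinity.
  have hg : Tendsto (fun n => (4 / (1 - 1 / α) * D)⁻¹ * f n) atTop atTop :=
    hf.const_mul_atTop (by positivity)
  refine ⟨_, isNegligible_rpow_neg hg, Cuckoo.isStronglyRobust_CH hα hg hkb K hK ?_⟩
  filter_upwards [hbound.bound] with n hn
  rw [Real.norm_natCast] at hn
  calc 4 / (1 - 1 / α) * ((4 / (1 - 1 / α) * D)⁻¹ * f n * Real.log n)
      = D⁻¹ * (f n * Real.log n) := by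
        have := hC.ne'
        generalize 4 / (1 - 1 / α) = γ at this
        field_simp
    _ ≤ D⁻¹ * (D * k n) :=
        mul_le_mul_of_nonneg_left ((Real.le_norm_self _).trans hn) (by positivity)
    _ = k n := by field_simp
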